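/- Let $\mathsf{Pos}$ be the category of posets and monotone maps, and let $\mathsf{Pos}_{\mathsf f}$ be a set of finite posets (called contexts) representing all finite posets up to isomorphism. A signature is a family $\Sigma=(\Sigma_\Gamma)_{\Gamma\in\mathsf{Pos}_{\mathsf f}}$ of sets. A $\Sigma$-algebra is a poset $A$ with a (not necessarily monotone) function $\sigma_A\colon\mathsf{Pos}_0(\Gamma,A)\to A$ for every $\Gamma$ and every $\sigma\in\Sigma_\Gamma$, where $\mathsf{Pos}_0(\Gamma,A)$ is the set of monotone maps $\Gamma\to A$. A homomorphism $h\colon A\to B$ is a monotone map with $h(\sigma_A(f))=\sigma_B(h\cdot f)$ for all $\sigma$ and $f$. The algebra $A$ is coherent if every $\sigma_A$ is monotone for the pointwise order on monotone maps. Terms in context $\Gamma$ are the usual ones over the set $|\Gamma|$, the order of arities being ignored: each $x\in|\Gamma|$ is a term, and for $\sigma\in\Sigma_\Delta$ and each function $g$ from $|\Delta|$ to terms, $\sigma(g)$ is a term. For a monotone $f\colon\Gamma\to A$ the evaluation $f^\#$ is the partial map from terms to $A$ with $f^\#(x)=f(x)$ for $x \in |\Gamma|$, and with $f^\#(\sigma(g))=\sigma_A(f^\#\cdot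 g)$, defined iff all $f^\#(g(i))$, $i\in\Delta$, are defined and $i\le j$ in $\Delta$ implies $f^\#(g(i))\le f^\#(g(j))$. The algebra $A$ satisfies an inequation $\Gamma\vdash s\le t$ between terms in context $\Gamma$ if for every monotone $f\colon\Gamma\to A$ both $f^\#(s)$ and $f^\#(t)$ are defined and $f^\#(s)\le f^\#(t)$. A variety is the full subcategory of the category of all $\Sigma$-algebras (or of the category of all coherent $\Sigma$-algebras) given by the algebras that satisfy every member of a given set of inequations in context. For every variety $\mathcal V$, of $\Sigma$-algebras or of coherent $\Sigma$-algebras, the forgetful functor $U\colon\mathcal V\to\mathsf{Pos}$ has a left adjoint; let $\mathbb T_{\mathcal V}$ be the monad on $\mathsf{Pos}$ of the resulting adjunction (the free-algebra monad). Then $\mathcal V$ is isomorphic, as a concrete category over $\mathsf{Pos}$, to the Eilenberg--Moore category $\mathsf{Pos}^{\mathbb T_{\mathcal V}}$; that is, there is an isomorphism of categories $K\colon\mathcal V\to\mathsf{Pos}^{\mathbb T_{\mathcal V}}$ whose composite with the forgetful functor $\mathsf{Pos}^{\mathbb T_{\mathcal V}}\to\mathsf{Pos}$ equals $U$. -/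

import Mathlib

open CategoryTheory

universe u

namespace OrdVar

/-- A partial order on a finite ordinal. -/
structure FinPoset : Type where
  card : ℕ
  order : PartialOrder (Fin card)

/-- The underlying set of a `FinPoset`, as a type of its own so that the order of `P` is not mixed up
with the usual linear order of `Fin n`. -/
def FinPoset.Elem (P : FinPoset) : Type := Fin P.card

instance (P : FinPoset) : PartialOrder P.Elem := P.order

instance (P : FinPoset) : Fintype P.Elem := inferInstanceAs (Fintype (Fin P.card))

/-- Order isomorphism of finite posets. -/
instance FinPoset.isoSetoid : Setoid FinPoset where
  r P Q := Nonempty (P.Elem ≃o Q.Elem)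
  iseqv := ⟨fun _ => ⟨OrderIso.refl _⟩, fun ⟨e⟩ => ⟨e.symm⟩, fun ⟨e⟩ ⟨e'⟩ => ⟨e.trans e'⟩⟩

/-- The set of contexts: isomorphism classes of finite posets, each of which stands for one chosen
representative (`PosF.Elem`). -/
def PosF : Type := Quotient FinPoset.isoSetoid

/-- The poset of variables of a context: the chosen representative of the class. -/
noncomputable def PosF.Elem (Γ : PosF) : Type := (Quotient.out Γ).Elem

noncomputable instance (Γ : PosF) : PartialOrder Γ.Elem :=
  inferInstanceAs (PartialOrder (Quotient.out Γ).Elem)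

noncomputable instance (Γ : PosF) : Fintype Γ.Elem :=
  inferInstanceAs (Fintype (Quotient.out Γ).Elem)

/-- Every finite poset is isomorphic to exactly one context. -/
theorem PosF.existsUnique_iso (P : Type*) [PartialOrder P] [Finite P] :
    ∃! Γ : PosF, Nonempty (P ≃o Γ.Elem) := by
  obtain ⟨n, ⟨e⟩⟩ := Finite.exists_equiv_fin P
  let Q : FinPoset := ⟨n, PartialOrder.lift e.symm e.symm.injective⟩
  let i : P ≃o Q.Elem := ⟨e, by
    intro a b
    change e.symm (e a) ≤ e.symm (e b) ↔ a ≤ b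
    simp⟩
  let Γ₀ : PosF := Quotient.mk FinPoset.isoSetoid Q
  obtain ⟨j⟩ : Nonempty (Γ₀.Elem ≃o Q.Elem) := Quotient.mk_out (s := FinPoset.isoSetoid) Q
  refine ⟨Γ₀, ⟨i.trans j.symm⟩, ?_⟩
  rintro Γ ⟨k⟩
  have h : Quotient.mk FinPoset.isoSetoid (Quotient.out Γ) = Γ₀ :=
    Quotient.sound ⟨k.symm.trans i⟩
  exact (Quotient.out_eq Γ).symm.trans h

/-- A signature in context: a family of sets `S Γ` of operation symbols of arity `Γ`. -/
abbrev Signature : Type (u + 1) := PosF → Type u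

/-- An `S`-algebra: a poset with an element `op σ f` for every operation symbol `σ` of arity `Γ` and
every monotone map `f` from `Γ`. The operations need not be monotone. -/
structure Alg (S : Signature.{u}) : Type (u + 1) where
  carrier : PartOrd.{u}
  op : ∀ {Γ : PosF}, S Γ → (Γ.Elem →o carrier) → carrier

/-- Homomorphisms: monotone maps that commute with the operations. -/
@[ext]
structure Alg.Hom {S : Signature.{u}} (A B : Alg S) : Type u where
  toOrderHom : A.carrier →o B.carrier
  map_op : ∀ {Γ : PosF} (σ : S Γ) (f : Γ.Elem →o A.carrier),
    toOrderHom (A.op σ f) = B.op σ (toOrderHom.comp f)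

/-- The category of `S`-algebras and monotone homomorphisms. -/
instance (S : Signature.{u}) : Category.{u} (Alg S) where
  Hom A B := Alg.Hom A B
  id A := ⟨OrderHom.id, fun _ _ => rfl⟩
  comp g h := ⟨h.toOrderHom.comp g.toOrderHom, fun σ f => by
    simp only [OrderHom.comp_coe, Function.comp_apply, g.map_op, h.map_op]
    rfl⟩

/-- The forgetful functor to posets. -/
def Alg.forget (S : Signature.{u}) : Alg S ⥤ PartOrd.{u} where
  obj A := A.carrier
  map h := PartOrd.ofHom h.toOrderHom

/-- An algebra is coherent if every operation is monotone for the pointwise order on monotone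
maps. -/
def Alg.Coherent {S : Signature.{u}} (A : Alg S) : Prop :=
  ∀ {Γ : PosF} (σ : S Γ), Monotone (A.op σ)

/-- The category of coherent `S`-algebras. -/
abbrev CohAlg (S : Signature.{u}) : Type (u + 1) :=
  ObjectProperty.FullSubcategory (fun A : Alg S => A.Coherent)

/-- Terms in context `Γ`; the order of the arities is ignored. -/
inductive Term (S : Signature.{u}) (Γ : PosF) : Type u
  | var (x : Γ.Elem) : Term S Γ
  | op {Δ : PosF} (σ : S Δ) (g : Δ.Elem → Term S Γ) : Term S Γ

/-- The partial evaluation map of a monotone interpretation `f` of the variables: `σ(g)` has a value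
iff all `g i` have values and these depend monotonically on `i`. -/
noncomputable def Alg.eval {S : Signature.{u}} (A : Alg S) {Γ : PosF} (f : Γ.Elem →o A.carrier) :
    Term S Γ → Part A.carrier
  | .var x => Part.some (f x)
  | .op σ g =>
    ⟨∃ h : ∀ i, (A.eval f (g i)).Dom, Monotone fun i => (A.eval f (g i)).get (h i),
      fun p => A.op σ ⟨fun i => (A.eval f (g i)).get (p.fst i), p.snd⟩⟩

/-- An inequation in context, `ctx ⊢ lhs ≤ rhs`. -/
structure Inequation (S : Signature.{u}) : Type u where
  ctx : PosF
  lhs : Term S ctx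
  rhs : Term S ctx

/-- Satisfaction: under every monotone interpretation both sides are defined, and the inequality
holds. -/
def Alg.Satisfies {S : Signature.{u}} (A : Alg S) (e : Inequation S) : Prop :=
  ∀ f : e.ctx.Elem →o A.carrier,
    ∃ (hl : (A.eval f e.lhs).Dom) (hr : (A.eval f e.rhs).Dom),
      (A.eval f e.lhs).get hl ≤ (A.eval f e.rhs).get hr

/-- The variety of `S`-algebras specified by a set `E` of inequations in context, as a full
subcategory of the category of `S`-algebras. -/
abbrev Variety (S : Signature.{u}) (E : Set (Inequation S)) : Type (u + 1) :=
  ObjectProperty.FullSubcategory (fun A : Alg S => ∀ e ∈ E, A.Satisfies e)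

/-- The forgetful functor of a variety. -/
def Variety.forget (S : Signature.{u}) (E : Set (Inequation S)) : Variety S E ⥤ PartOrd.{u} :=
  ObjectProperty.ι _ ⋙ Alg.forget S

/-- The variety of coherent `S`-algebras specified by a set `E` of inequations in context, as a full
subcategory of the category of coherent `S`-algebras. -/
abbrev CohVariety (S : Signature.{u}) (E : Set (Inequation S)) : Type (u + 1) :=
  ObjectProperty.FullSubcategory (fun A : CohAlg S => ∀ e ∈ E, A.obj.Satisfies e)

/-- The forgetful functor of a variety of coherent algebras. -/
def CohVariety.forget (S : Signature.{u}) (E : Set (Inequation S)) :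
    CohVariety S E ⥤ PartOrd.{u} :=
  ObjectProperty.ι _ ⋙ ObjectProperty.ι _ ⋙ Alg.forget S

/-- Two categories `C`, `D`, concrete over `B` by `U` and `V`, are isomorphic as concrete categories:
there is an isomorphism of categories (not only an equivalence) that strictly commutes with the
functors to `B`. -/
def ConcretelyIsomorphic {B C D : Type*} [Category* B] [Category* C] [Category* D]
    (U : C ⥤ B) (V : D ⥤ B) : Prop :=
  ∃ (K : C ⥤ D) (L : D ⥤ C), K ⋙ L = 𝟭 C ∧ L ⋙ K = 𝟭 D ∧ K ⋙ V = U

end OrdVar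

/-! Satisfaction of inequations and coherence share two closure properties, collected in
`VarietyLike`, and these two suffice. Inheritance by separated algebras yields free algebras: take
the terms defined under every interpretation in every algebra of the class, ordered by comparing all
values. Such terms form a small type although the class is large, and the quotient is separated by
construction. Inheritance along monotonically split homomorphisms handles Eilenberg–Moore algebras:
a structure map `a : TY → Y` induces operations `a (σ (η ∘ f))` on `Y`, associativity makes `a` a
homomorphism (`inducedHom`), and the unit law splits it by `η`, so `Y` lies in the class. Hence the
comparison functor is fully faithful and bijective on objects. No Beck-type criterion is needed. -/

namespace OrdVar

variable {S : Signature.{u}}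

/-! ### Isomorphisms of concrete categories. -/

section ConcreteIsomorphism

variable {B C D : Type*} [Category* B] [Category* C] [Category* D]

/-- A fully faithful functor that is bijective on objects is an isomorphism of categories. -/
theorem ConcretelyIsomorphic.of_bijective_obj {U : C ⥤ B} {V : D ⥤ B} (K : C ⥤ D) [K.Full]
    [K.Faithful] (hK : Function.Bijective K.obj) (h : K ⋙ V = U) : ConcretelyIsomorphic U V := by
  choose o ho using hK.2
  let L : D ⥤ C :=
    { obj := o
      map := fun {X Y} f => K.preimage (eqToHom (ho X) ≫ f ≫ eqToHom (ho Y).symm)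
      map_id := fun X => K.map_injective (by simp)
      map_comp := fun f g => K.map_injective (by simp) }
  have hL : ∀ X, o (K.obj X) = X := fun X => hK.1 (ho (K.obj X))
  refine ⟨K, L, CategoryTheory.Functor.ext hL fun X Y f => K.map_injective ?_,
    CategoryTheory.Functor.ext ho fun X Y f => ?_, h⟩
  · simp [L, eqToHom_map]
  · simp [L]

end ConcreteIsomorphism

/-! ### Closure properties of satisfaction and coherence. -/

section Evaluation

/-- Homomorphisms preserve definedness and values of terms. -/
theorem Alg.Hom.eval_comp {A B : Alg S} (h : Alg.Hom A B) {Γ : PosF} (f : Γ.Elem →o A.carrier)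
    (t : Term S Γ) (ht : (A.eval f t).Dom) :
    ∃ ht' : (B.eval (h.toOrderHom.comp f) t).Dom,
      (B.eval (h.toOrderHom.comp f) t).get ht' = h.toOrderHom ((A.eval f t).get ht) := by
  induction t with
  | var x => exact ⟨trivial, rfl⟩
  | op σ g ih =>
    obtain ⟨hd, hm⟩ := ht
    choose hd' heq using fun i => ih i (hd i)
    have hm' : Monotone fun i => (B.eval (h.toOrderHom.comp f) (g i)).get (hd' i) := by
      intro i j hij
      simp only [heq]
      exact h.toOrderHom.monotone (hm hij)
    refine ⟨⟨hd', hm'⟩, ?_⟩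
    refine Eq.trans ?_ (h.map_op σ _).symm
    exact congrArg (B.op σ) (OrderHom.ext _ _ (funext heq))

/-- The homomorphisms from `A` to the algebras with property `P` jointly reflect the order. -/
def Alg.Separated (P : Alg S → Prop) (A : Alg S) : Prop :=
  ∀ a b : A.carrier,
    (∀ B, P B → ∀ h : Alg.Hom A B, h.toOrderHom a ≤ h.toOrderHom b) → a ≤ b

/-- Definedness of `σ(g)` is an order condition on the values of the `g i`, so it can be tested
along the separating homomorphisms. -/
theorem Alg.Separated.eval_dom {P : Alg S → Prop} {A : Alg S} (hA : A.Separated P) {Γ : PosF}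
    (f : Γ.Elem →o A.carrier) (t : Term S Γ)
    (ht : ∀ B, P B → ∀ h : Alg.Hom A B, (B.eval (h.toOrderHom.comp f) t).Dom) :
    (A.eval f t).Dom := by
  induction t with
  | var x => trivial
  | op σ g ih =>
    have hd : ∀ i, (A.eval f (g i)).Dom := fun i => ih i fun B hB h => (ht B hB h).fst i
    refine ⟨hd, fun i j hij => hA _ _ fun B hB h => ?_⟩
    obtain ⟨hd', hm'⟩ := ht B hB h
    have := hm' hij
    obtain ⟨_, hi⟩ := h.eval_comp f (g i) (hd i)
    obtain ⟨_, hj⟩ := h.eval_comp f (g j) (hd j)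
    exact hi ▸ hj ▸ this

/-- A property of algebras is variety-like if it is inherited by order-separated algebras
and by homomorphic images along homomorphisms split by a monotone map. -/
structure VarietyLike (P : Alg S → Prop) : Prop where
  of_separated : ∀ A : Alg S, A.Separated P → P A
  of_split : ∀ {A B : Alg S}, P A → ∀ (h : Alg.Hom A B) (s : B.carrier →o A.carrier),
    (∀ b, h.toOrderHom (s b) = b) → P B

theorem varietyLike_satisfies (e : Inequation S) : VarietyLike fun A : Alg S => A.Satisfies e where
  of_separated A hA f := by
    have hl := hA.eval_dom f e.lhs fun B hB h => (hB (h.toOrderHom.comp f)).fst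
    have hr := hA.eval_dom f e.rhs fun B hB h => (hB (h.toOrderHom.comp f)).snd.fst
    refine ⟨hl, hr, hA _ _ fun B hB h => ?_⟩
    obtain ⟨_, hl'⟩ := h.eval_comp f _ hl
    obtain ⟨_, hr'⟩ := h.eval_comp f _ hr
    obtain ⟨_, _, hle⟩ := hB (h.toOrderHom.comp f)
    exact hl' ▸ hr' ▸ hle
  of_split {A B} hA h s hs f := by
    -- The section must be monotone, so that `s ∘ f` is again an interpretation; it need not be a
    -- homomorphism.
    obtain ⟨hl, hr, hle⟩ := hA (s.comp f)
    have hf : h.toOrderHom.comp (s.comp f) = f := OrderHom.ext _ _ (funext fun x => hs (f x))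
    have hl' := h.eval_comp (s.comp f) _ hl
    have hr' := h.eval_comp (s.comp f) _ hr
    rw [hf] at hl' hr'
    obtain ⟨hdl, hl'⟩ := hl'
    obtain ⟨hdr, hr'⟩ := hr'
    refine ⟨hdl, hdr, ?_⟩
    rw [hl', hr']
    exact h.toOrderHom.monotone hle

theorem varietyLike_coherent : VarietyLike fun A : Alg S => A.Coherent where
  of_separated A hA Γ σ f g hfg := hA _ _ fun B hB h => by
    rw [h.map_op, h.map_op]
    exact hB σ fun i => h.toOrderHom.monotone (hfg i)
  of_split {A B} hA h s hs Γ σ f g hfg := by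
    have key : ∀ f : Γ.Elem →o B.carrier, B.op σ f = h.toOrderHom (A.op σ (s.comp f)) := fun f => by
      rw [h.map_op]
      exact congrArg (B.op σ) (OrderHom.ext _ _ (funext fun x => (hs (f x)).symm))
    rw [key, key]
    exact h.toOrderHom.monotone (hA σ fun i => s.monotone (hfg i))

theorem Alg.Separated.mono {P Q : Alg S → Prop} (hPQ : ∀ A, P A → Q A) {A : Alg S}
    (hA : A.Separated P) : A.Separated Q :=
  fun a b hab => hA a b fun B hB => hab B (hPQ B hB)

theorem VarietyLike.forall {ι : Sort*} {P : ι → Alg S → Prop} (hP : ∀ i, VarietyLike (P i)) :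
    VarietyLike fun A => ∀ i, P i A where
  of_separated A hA i := (hP i).of_separated A (hA.mono fun _ h => h i)
  of_split hA h s hs i := (hP i).of_split (hA i) h s hs

theorem VarietyLike.and {P Q : Alg S → Prop} (hP : VarietyLike P) (hQ : VarietyLike Q) :
    VarietyLike fun A => P A ∧ Q A where
  of_separated A hA :=
    ⟨hP.of_separated A (hA.mono fun _ h => h.1), hQ.of_separated A (hA.mono fun _ h => h.2)⟩
  of_split hA h s hs := ⟨hP.of_split hA.1 h s hs, hQ.of_split hA.2 h s hs⟩

end Evaluation

/-! ### Free algebras from everywhere defined terms. -/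

section FreeAlgebra

/-- Terms over a set of generators that need not be finite. -/
inductive GenTerm (S : Signature.{u}) (X : Type u) : Type u
  | gen (x : X) : GenTerm S X
  | op {Δ : PosF} (σ : S Δ) (g : Δ.Elem → GenTerm S X) : GenTerm S X

/-- `A.Value f t a` says that `t` has the value `a` under the interpretation `f`. -/
inductive Alg.Value {X : PartOrd.{u}} (A : Alg S) (f : X →o A.carrier) : GenTerm S X →
    A.carrier → Prop
  | gen (x : X) : Alg.Value A f (.gen x) (f x)
  | op {Δ : PosF} (σ : S Δ) (g : Δ.Elem → GenTerm S X) (v : Δ.Elem →o A.carrier)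
      (h : ∀ i, Alg.Value A f (g i) (v i)) : Alg.Value A f (.op σ g) (A.op σ v)

theorem Alg.Value.unique {X : PartOrd.{u}} {A : Alg S} {f : X →o A.carrier} {t : GenTerm S X}
    {a b : A.carrier} (ha : A.Value f t a) (hb : A.Value f t b) : a = b := by
  induction ha generalizing b with
  | gen x => cases hb; rfl
  | op σ g v h ih =>
    cases hb with
    | op _ _ w hw => exact congrArg (A.op σ) (OrderHom.ext _ _ (funext fun i => ih i (hw i)))

variable (P : Alg S → Prop) (X : PartOrd.{u})

/-- The terms that have a value under every interpretation in an algebra with property `P`. -/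
def DefTerm : Type u :=
  {t : GenTerm S X // ∀ A, P A → ∀ f : X →o A.carrier, ∃ a, A.Value f t a}

variable {P X}

/-- The value of an everywhere defined term. -/
noncomputable def DefTerm.val (t : DefTerm P X) {A : Alg S} (hA : P A) (f : X →o A.carrier) :
    A.carrier :=
  (t.2 A hA f).choose

theorem DefTerm.value_val (t : DefTerm P X) {A : Alg S} (hA : P A) (f : X →o A.carrier) :
    A.Value f t.1 (t.val hA f) :=
  (t.2 A hA f).choose_spec

instance : Preorder (DefTerm P X) where
  le s t := ∀ (A : Alg S) (hA : P A) (f : X →o A.carrier), s.val hA f ≤ t.val hA f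
  le_refl _ _ _ _ := le_rfl
  le_trans _ _ _ h h' A hA f := (h A hA f).trans (h' A hA f)

variable (P X) in
/-- The underlying poset of the free algebra. -/
abbrev FreeCarrier : Type u := Antisymmetrization (DefTerm P X) (· ≤ ·)

/-- The class of an everywhere defined term. -/
def FreeCarrier.mk (t : GenTerm S X)
    (ht : ∀ A, P A → ∀ f : X →o A.carrier, ∃ a, A.Value f t a) : FreeCarrier P X :=
  toAntisymmetrization _ (⟨t, ht⟩ : DefTerm P X)

/-- The value of an element of the free algebra. -/
noncomputable def FreeCarrier.val {A : Alg S} (hA : P A) (f : X →o A.carrier) :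
    FreeCarrier P X →o A.carrier where
  toFun := Quotient.lift (fun t : DefTerm P X => t.val hA f)
    fun _ _ h => le_antisymm (h.1 A hA f) (h.2 A hA f)
  monotone' := by
    rintro ⟨s⟩ ⟨t⟩ h
    exact h A hA f

theorem FreeCarrier.le_iff {s t : FreeCarrier P X} :
    s ≤ t ↔ ∀ (A : Alg S) (hA : P A) (f : X →o A.carrier), val hA f s ≤ val hA f t := by
  induction s using Quotient.inductionOn
  induction t using Quotient.inductionOn
  rfl

theorem FreeCarrier.value_out (t : FreeCarrier P X) {A : Alg S} (hA : P A) (f : X →o A.carrier) :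
    A.Value f (Quotient.out t).1 (val hA f t) := by
  have h := (Quotient.out t).value_val hA f
  have h' : val hA f t = (Quotient.out t).val hA f := by
    conv_lhs => rw [← Quotient.out_eq t]
    rfl
  rwa [h']

theorem FreeCarrier.val_mk {t : GenTerm S X}
    (ht : ∀ A, P A → ∀ f : X →o A.carrier, ∃ a, A.Value f t a) {A : Alg S} (hA : P A)
    {f : X →o A.carrier} {a : A.carrier} (ha : A.Value f t a) :
    val hA f (mk t ht) = a :=
  (DefTerm.value_val ⟨t, ht⟩ hA f).unique ha

theorem FreeCarrier.ext {s t : FreeCarrier P X}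
    (h : ∀ (A : Alg S) (hA : P A) (f : X →o A.carrier), val hA f s = val hA f t) : s = t :=
  le_antisymm (le_iff.2 fun A hA f => (h A hA f).le) (le_iff.2 fun A hA f => (h A hA f).ge)

variable (P X) in
/-- The algebra freely generated by `X` with respect to the algebras with property `P`. -/
noncomputable def freeAlg : Alg S where
  carrier := PartOrd.of (FreeCarrier P X)
  -- The chosen representatives have monotone values because `g` is monotone, so the composite term
  -- is everywhere defined.
  op σ g := FreeCarrier.mk (.op σ fun i => (Quotient.out (g i)).1) fun _ hA f =>
    ⟨_, .op σ _ ((FreeCarrier.val hA f).comp g) fun i => (g i).value_out hA f⟩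

/-- The homomorphism from the free algebra that extends `f`. -/
noncomputable def freeLift {A : Alg S} (hA : P A) (f : X →o A.carrier) :
    Alg.Hom (freeAlg P X) A where
  toOrderHom := FreeCarrier.val hA f
  map_op σ g := FreeCarrier.val_mk _ hA
    (.op σ _ ((FreeCarrier.val hA f).comp g) fun i => FreeCarrier.value_out (g i) hA f)

theorem freeAlg_separated : (freeAlg P X).Separated P := fun _ _ h =>
  FreeCarrier.le_iff.2 fun A hA f => h A hA (freeLift hA f)

variable (P X) in
/-- The inclusion of the generators into the free algebra. -/
def freeUnit : X →o (freeAlg P X).carrier where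
  toFun x := FreeCarrier.mk (.gen x) fun _ _ f => ⟨f x, .gen x⟩
  monotone' x y h := FreeCarrier.le_iff.2 fun A hA f => by
    rw [FreeCarrier.val_mk _ hA (.gen x), FreeCarrier.val_mk _ hA (.gen y)]
    exact f.monotone h

theorem freeLift_comp_unit {A : Alg S} (hA : P A) (f : X →o A.carrier) :
    (freeLift hA f).toOrderHom.comp (freeUnit P X) = f :=
  OrderHom.ext _ _ (funext fun x => FreeCarrier.val_mk _ hA (.gen x))

/-- The class of a term in the free algebra is sent by every homomorphism to a value of the term. -/
theorem value_hom_mk {A : Alg S} (h : Alg.Hom (freeAlg P X) A) (t : GenTerm S X)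
    (ht : ∀ A, P A → ∀ f : X →o A.carrier, ∃ a, A.Value f t a) :
    A.Value (h.toOrderHom.comp (freeUnit P X)) t
      (h.toOrderHom (FreeCarrier.mk t ht)) := by
  induction t with
  | gen x => exact .gen x
  | @op Δ σ g ih =>
    -- Definedness of `σ(g)` forces the arguments to be everywhere defined with values monotone in
    -- `i`; hence their classes form a monotone family `v`.
    have hv : ∀ B, P B → ∀ f : X →o B.carrier,
        ∃ w : Δ.Elem →o B.carrier, ∀ i, B.Value f (g i) (w i) := fun B hB f => by
      obtain ⟨a, ha⟩ := ht B hB f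
      cases ha with
      | op _ _ w hw => exact ⟨w, hw⟩
    have hg : ∀ i, ∀ B, P B → ∀ f : X →o B.carrier, ∃ a, B.Value f (g i) a := fun i B hB f =>
      (hv B hB f).imp' (fun w => w i) fun w hw => hw i
    let v : Δ.Elem →o (freeAlg P X).carrier :=
      { toFun := fun i => FreeCarrier.mk (g i) (hg i)
        monotone' := fun i j hij => FreeCarrier.le_iff.2 fun B hB f => by
          obtain ⟨w, hw⟩ := hv B hB f
          rw [FreeCarrier.val_mk _ hB (hw i), FreeCarrier.val_mk _ hB (hw j)]
          exact w.monotone hij }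
    -- The operation uses chosen representatives in place of the `g i`, so the two classes are
    -- compared through their values.
    have key : FreeCarrier.mk (.op σ g) ht = (freeAlg P X).op σ v :=
      FreeCarrier.ext fun B hB f => by
        refine (FreeCarrier.val_mk ht hB (.op σ g ((FreeCarrier.val hB f).comp v) fun i => ?_)).trans
          ((freeLift hB f).map_op σ v).symm
        exact DefTerm.value_val ⟨g i, hg i⟩ hB f
    rw [key, h.map_op]
    exact .op σ g _ fun i => ih i (hg i)

theorem freeAlg_hom_ext {A : Alg S} {h k : Alg.Hom (freeAlg P X) A}
    (hk : h.toOrderHom.comp (freeUnit P X) = k.toOrderHom.comp (freeUnit P X)) : h = k := by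
  refine Alg.Hom.ext (OrderHom.ext _ _ (funext fun t => ?_))
  induction t using Quotient.inductionOn with
  | h t => exact (value_hom_mk h t.1 t.2).unique (hk ▸ value_hom_mk k t.1 t.2)

end FreeAlgebra

/-! ### The adjunction and the comparison functor. -/

section Monadicity

variable {P : Alg S → Prop} {V : Type (u + 1)} [Category.{u} V] (I : V ⥤ Alg S)

/-- The forgetful functor of a full subcategory of algebras given by a variety-like property has a
left adjoint. -/
theorem isRightAdjoint_forget [I.Full] [I.Faithful] (hP : VarietyLike P) (hI : ∀ v, P (I.obj v))
    (hobj : ∀ A, P A → ∃ v, I.obj v = A) : (I ⋙ Alg.forget S).IsRightAdjoint := by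
  have free : ∀ X : PartOrd.{u}, ∃ (v : V) (η : X →o (I.obj v).carrier),
      ∀ (w : V) (f : X →o (I.obj w).carrier),
        ∃! g : Alg.Hom (I.obj v) (I.obj w), g.toOrderHom.comp η = f := fun X => by
    obtain ⟨v, hv⟩ := hobj _ (hP.of_separated _ (freeAlg_separated (P := P) (X := X)))
    refine ⟨v, ?_⟩
    -- The generator map is still part of the goal here, so its type is rewritten along with the
    -- algebra.
    rw [hv]
    exact ⟨freeUnit P X, fun w f => ⟨freeLift (hI w) f, freeLift_comp_unit (hI w) f, fun g hg =>
      freeAlg_hom_ext (hg.trans (freeLift_comp_unit (hI w) f).symm)⟩⟩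
  have : ∀ X, Limits.HasInitial (StructuredArrow X (I ⋙ Alg.forget S)) := fun X => by
    obtain ⟨v, η, h⟩ := free X
    let ini : StructuredArrow X (I ⋙ Alg.forget S) :=
      StructuredArrow.mk (Y := v) (PartOrd.ofHom η)
    refine (Limits.IsInitial.ofUniqueHom (X := ini) (fun Y =>
      StructuredArrow.homMk (I.preimage (h Y.right Y.hom.hom).choose) ?_) fun Y m => ?_).hasInitial
    · have := (h Y.right Y.hom.hom).choose_spec.1
      refine PartOrd.hom_ext (Eq.trans ?_ this)
      simp only [Functor.comp_map, Functor.map_preimage]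
      rfl
    · refine StructuredArrow.hom_ext _ _ (I.map_injective ?_)
      refine ((h Y.right Y.hom.hom).choose_spec.2 (I.map m.right) ?_).trans
        (I.map_preimage _).symm
      exact congrArg PartOrd.Hom.hom (StructuredArrow.w m)
  exact isRightAdjointOfStructuredArrowInitials _

variable {I} {F : PartOrd.{u} ⥤ V} (adj : F ⊣ I ⋙ Alg.forget S)

/-- The operations on a poset that are induced by a map from the free algebra. -/
noncomputable def inducedOp {X Y : PartOrd.{u}} (a : (I.obj (F.obj X)).carrier →o Y) {Γ : PosF}
    (σ : S Γ) (f : Γ.Elem →o X) : Y :=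
  a ((I.obj (F.obj X)).op σ ((adj.unit.app X).hom.comp f))

/-- The counit is a homomorphism, and `ε ∘ η = id` by a triangle identity. -/
theorem op_eq_inducedOp_counit (v : V) {Γ : PosF} (σ : S Γ) (f : Γ.Elem →o (I.obj v).carrier) :
    (I.obj v).op σ f = inducedOp adj (I.map (adj.counit.app v)).toOrderHom σ f := by
  refine Eq.trans ?_ ((I.map (adj.counit.app v)).map_op σ _).symm
  refine congrArg ((I.obj v).op σ) (OrderHom.ext _ _ (funext fun x => ?_))
  exact (congrArg (fun k => k.hom (f x)) (adj.right_triangle_components v)).symm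

/-- Naturality of the unit, together with `F k` being a homomorphism. -/
theorem map_inducedOp {X Y Z : PartOrd.{u}} (k : X →o Y) (a : (I.obj (F.obj Y)).carrier →o Z)
    {Γ : PosF} (σ : S Γ) (f : Γ.Elem →o X) :
    inducedOp adj a σ (k.comp f) =
      inducedOp adj (a.comp (I.map (F.map (PartOrd.ofHom k))).toOrderHom) σ f := by
  refine congrArg a (Eq.trans ?_ ((I.map (F.map (PartOrd.ofHom k))).map_op σ _).symm)
  refine congrArg ((I.obj (F.obj Y)).op σ) (OrderHom.ext _ _ (funext fun x => ?_))
  exact congrArg (fun k => k.hom (f x)) (adj.unit.naturality (PartOrd.ofHom k))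

/-- A monotone map that commutes with the counits commutes with the operations. -/
theorem map_op_of_counit {A B : V} (k : (I.obj A).carrier →o (I.obj B).carrier)
    (hk : (I.map (adj.counit.app B)).toOrderHom.comp
        (I.map (F.map (PartOrd.ofHom k))).toOrderHom =
      k.comp (I.map (adj.counit.app A)).toOrderHom)
    {Γ : PosF} (σ : S Γ) (f : Γ.Elem →o (I.obj A).carrier) :
    k ((I.obj A).op σ f) = (I.obj B).op σ (k.comp f) := by
  refine Eq.trans ?_ (op_eq_inducedOp_counit adj B σ (k.comp f)).symm
  refine Eq.trans ?_ (map_inducedOp adj k _ σ f).symm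
  refine Eq.trans ?_ (congrArg (fun l => inducedOp adj l σ f) hk).symm
  exact congrArg k (op_eq_inducedOp_counit adj A σ f)

theorem comparison_full [I.Full] : (Monad.comparison adj).Full where
  map_surjective {A B} h :=
    ⟨I.preimage (X := A) (Y := B)
      ⟨h.f.hom, map_op_of_counit adj (A := A) (B := B) h.f.hom (congrArg PartOrd.Hom.hom h.h)⟩,
      Monad.Algebra.Hom.ext (congrArg (Alg.forget S).map (I.map_preimage _))⟩

/-- The algebra structure on the underlying poset of an Eilenberg-Moore algebra. -/
noncomputable def inducedAlg (Y : adj.toMonad.Algebra) : Alg S where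
  carrier := Y.A
  op σ f := inducedOp adj Y.a.hom σ f

theorem inducedAlg_comparison (v : V) : inducedAlg adj ((Monad.comparison adj).obj v) = I.obj v :=
  congrArg (Alg.mk (I.obj v).carrier) (by
    funext Γ σ f
    exact (op_eq_inducedOp_counit adj v σ f).symm)

/-- `inducedAlg` recovers the algebra from its image. -/
theorem comparison_obj_injective (hinj : Function.Injective I.obj) :
    Function.Injective (Monad.comparison adj).obj := fun A B h =>
  hinj (by rw [← inducedAlg_comparison adj A, h, inducedAlg_comparison])

/-- The structure map of an Eilenberg-Moore algebra is a homomorphism. -/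
def inducedHom (Y : adj.toMonad.Algebra) : Alg.Hom (I.obj (F.obj Y.A)) (inducedAlg adj Y) where
  toOrderHom := Y.a.hom
  map_op σ f := by
    -- The associativity law; the counit at a free object is the monad multiplication.
    have h : (Y.a.hom).comp (I.map (F.map Y.a)).toOrderHom =
        (Y.a.hom).comp (I.map (adj.counit.app (F.obj Y.A))).toOrderHom :=
      congrArg PartOrd.Hom.hom Y.assoc.symm
    refine Eq.trans ?_ (map_inducedOp adj Y.a.hom Y.a.hom σ f).symm
    refine Eq.trans ?_ (congrArg (fun k => inducedOp adj k σ f) h).symm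
    exact congrArg Y.a.hom (op_eq_inducedOp_counit adj (F.obj Y.A) σ f)

/-- A homomorphism out of a free algebra that extends the identity is the counit. -/
theorem eq_counit [I.Full] (v : V) (h : Alg.Hom (I.obj (F.obj (I.obj v).carrier)) (I.obj v))
    (hh : adj.unit.app (I.obj v).carrier ≫ PartOrd.ofHom h.toOrderHom = 𝟙 (I.obj v).carrier) :
    h = I.map (adj.counit.app v) := by
  have : I.preimage h = adj.counit.app v := by
    refine (adj.homEquiv _ _).injective ?_
    refine (adj.homEquiv_unit _ _ _).trans (Eq.trans ?_ (adj.homEquiv_unit _ _ _).symm)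
    refine Eq.trans ?_ (adj.right_triangle_components v).symm
    rw [Functor.comp_map, I.map_preimage]
    exact hh
  exact (I.map_preimage h).symm.trans (congrArg I.map this)

/-- Stating the equation over the same carrier lets the operations be compared without a cast. -/
theorem Alg.op_eq_of_eq_mk {A : Alg S}
    {o : ∀ {Γ : PosF}, S Γ → (Γ.Elem →o A.carrier) → A.carrier} (h : A = ⟨A.carrier, o⟩)
    {Γ : PosF} (σ : S Γ) (f : Γ.Elem →o A.carrier) : A.op σ f = o σ f := by
  obtain ⟨c, p⟩ := A
  have hp : @p = @o := eq_of_heq (Alg.mk.inj h).2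
  exact congrFun (congrFun (congrFun hp Γ) σ) f

/-- The structure map of `Y` is a homomorphism extending the identity, hence equals the counit at
`v` by `eq_counit`. -/
theorem comparison_obj_eq [I.Full] {v : V} {Y : adj.toMonad.Algebra}
    (hv : I.obj v = inducedAlg adj Y) :
    (Monad.comparison adj).obj v = Y := by
  have key : ∀ {Γ : PosF} (σ : S Γ) (f : Γ.Elem →o (I.obj (F.obj Y.A)).carrier),
      Y.a.hom ((I.obj (F.obj Y.A)).op σ f) = inducedOp adj Y.a.hom σ (Y.a.hom.comp f) :=
    (inducedHom adj Y).map_op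
  obtain ⟨X, a, unit, assoc⟩ := Y
  have hX : (I.obj v).carrier = X := congrArg Alg.carrier hv
  subst hX
  have hv' : I.obj v = ⟨(I.obj v).carrier, fun σ f => inducedOp adj a.hom σ f⟩ := hv
  have h := eq_counit adj v
    ⟨a.hom, fun σ f => (key σ f).trans (Alg.op_eq_of_eq_mk hv' σ (a.hom.comp f)).symm⟩ unit
  have ha : (Alg.forget S).map (I.map (adj.counit.app v)) = a :=
    (congrArg (Alg.forget S).map h).symm
  subst ha
  rfl

theorem comparison_obj_surjective [I.Full] (hP : VarietyLike P) (hI : ∀ v, P (I.obj v))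
    (hobj : ∀ A, P A → ∃ v, I.obj v = A) : Function.Surjective (Monad.comparison adj).obj := by
  intro Y
  obtain ⟨v, hv⟩ := hobj (inducedAlg adj Y)
    (hP.of_split (hI _) (inducedHom adj Y) (adj.unit.app Y.A).hom fun b =>
      congrArg (fun k => k.hom b) Y.unit)
  exact ⟨v, comparison_obj_eq adj hv⟩

/-- A full subcategory of algebras given by a variety-like property is concretely isomorphic to the
Eilenberg-Moore category of its free-algebra monad. -/
theorem concretelyIsomorphic_algebra [I.Full] [I.Faithful] (hP : VarietyLike P)
    (hI : ∀ v, P (I.obj v))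
    (hobj : ∀ A, P A → ∃ v, I.obj v = A) (hinj : Function.Injective I.obj) :
    ConcretelyIsomorphic (I ⋙ Alg.forget S) adj.toMonad.forget := by
  -- Faithfulness of the right adjoint makes the comparison functor faithful.
  have : (Alg.forget S).Faithful := ⟨fun h => Alg.Hom.ext (congrArg PartOrd.Hom.hom h)⟩
  have := comparison_full adj
  exact .of_bijective_obj (Monad.comparison adj)
    ⟨comparison_obj_injective adj hinj, comparison_obj_surjective adj hP hI hobj⟩ rfl

end Monadicity

end OrdVar

/-- For every signature in context `S` and every set `E` of inequations in context, the forgetful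
functor of the variety has a left adjoint, and for the monad of any such adjunction (the free-algebra
monad) the variety is isomorphic, as a concrete category over posets, to the Eilenberg-Moore category
of the monad. The same holds for the variety of coherent algebras. -/
theorem corollaryC (S : OrdVar.Signature.{u}) (E : Set (OrdVar.Inequation S)) :
    ((OrdVar.Variety.forget S E).IsRightAdjoint ∧
      ∀ (F : PartOrd.{u} ⥤ OrdVar.Variety S E) (adj : F ⊣ OrdVar.Variety.forget S E),
        OrdVar.ConcretelyIsomorphic (OrdVar.Variety.forget S E) adj.toMonad.forget) ∧
    ((OrdVar.CohVariety.forget S E).IsRightAdjoint ∧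
      ∀ (F : PartOrd.{u} ⥤ OrdVar.CohVariety S E) (adj : F ⊣ OrdVar.CohVariety.forget S E),
        OrdVar.ConcretelyIsomorphic (OrdVar.CohVariety.forget S E) adj.toMonad.forget) := by
  have hE := OrdVar.VarietyLike.forall fun e : OrdVar.Inequation S =>
    OrdVar.VarietyLike.forall fun _ : e ∈ E => OrdVar.varietyLike_satisfies e
  have hC := OrdVar.varietyLike_coherent.and hE
  let I : OrdVar.CohVariety S E ⥤ OrdVar.Alg S := ObjectProperty.ι _ ⋙ ObjectProperty.ι _
  refine ⟨⟨OrdVar.isRightAdjoint_forget (ObjectProperty.ι _) hE (fun v => v.property)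
      fun A hA => ⟨⟨A, hA⟩, rfl⟩, fun F adj =>
      OrdVar.concretelyIsomorphic_algebra (I := ObjectProperty.ι _) adj hE (fun v => v.property)
        (fun A hA => ⟨⟨A, hA⟩, rfl⟩) fun _ _ h => ObjectProperty.FullSubcategory.ext h⟩,
    ⟨OrdVar.isRightAdjoint_forget I hC (fun v => ⟨v.obj.property, v.property⟩)
      fun A hA => ⟨⟨⟨A, hA.1⟩, hA.2⟩, rfl⟩, fun F adj =>
      OrdVar.concretelyIsomorphic_algebra (I := I) adj hC
        (fun v => ⟨v.obj.property, v.property⟩) (fun A hA => ⟨⟨⟨A, hA.1⟩, hA.2⟩, rfl⟩)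
        fun _ _ h => ObjectProperty.FullSubcategory.ext (ObjectProperty.FullSubcategory.ext h)⟩⟩
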